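/- Let $q=p^f$ be a prime power, let $V$ be a vector space of even dimension $2m>0$ over $\mathbb F_q$ (for instance $V=\mathbb F_q^{2m}$), and let $Q:V\to\mathbb F_q$ be a quadratic form with polar form $B(x,y)=Q(x+y)-Q(x)-Q(y)$. Assume that $Q$ is nonsingular: the only $w\in V$ with $Q(w)=0$ and $B(v,w)=0$ for all $v\in V$ is $w=0$. Then $Q$ is, up to an invertible linear change of coordinates, either hyperbolic, i.e. of the form $x_1x_2+x_3x_4+\cdots+x_{2m-1}x_{2m}$, or elliptic, i.e. of the form $x_1x_2+\cdots+x_{2m-3}x_{2m-2}+(\alpha x_{2m-1}^2+\beta x_{2m-1}x_{2m}+\delta x_{2m}^2)$ with $\alpha x^2+\beta xy+\delta y^2$ irreducible over $\mathbb F_q$. Put $\epsilon=1$ if $Q$ is hyperbolic and $\epsilon=-1$ if $Q$ is elliptic. Let $\psi_1$ and $\psi_1'$ be the canonical additive characters of $\mathbb F_q$ and $\mathbb F_{q^2}$, that is, $x\mapsto \exp(2\pi i\,\mathrm{Tr}(x)/p)$ with $\mathrm{Tr}$ the trace to $\mathbb F_p$. For $b\in V$ let $\phi_b(x)=\psi_1(B(b,x))$,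 $x\in V$. For a subset $D$ of a finite abelian group and an additive character $\chi$ of that group write $\chi(D)=\sum_{x\in D}\chi(x)$. Let $\gamma$ be a primitive element of $\mathbb F_{q^2}$ and $\omega=\mathrm{Norm}_{q^2/q}(\gamma)$. For $e\mid q-1$ and $0\le i\le e-1$ let $C_i^{(e,q)}=\omega^i\langle\omega^e\rangle\subseteq\mathbb F_q$ and $C_i^{(e,q^2)}=\gamma^i\langle\gamma^e\rangle\subseteq\mathbb F_{q^2}$. Let $D_{C_i^{(e,q)}}=\{x\in V: Q(x)\in C_i^{(e,q)}\}$ and $D_0=\{x\in V: Q(x)=0\}$. Then, for every $0\ne b\in V$ and all $0\le i\le e-1$, \[ \phi_b(D_{C_i^{(e,q)}})=\begin{cases}-\epsilon q^{m-1}\,\dfrac{q-1}{e}, & \text{if } Q(b)=0,\\[2mm] -\epsilon q^{m-1}\,\psi_1'\bigl(\gamma^{i+s}C_0^{(e,q^2)}\bigr), & \text{if } Q(b)\in C_s^{(e,q)},\ 0\le s\le e-1,\end{cases} \] and \[ \phi_b(D_0)=\begin{cases}\epsilon q^{m-1}(q-1), & \text{if } Q(b)=0,\\ -\epsilon q^{m-1},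 & \text{if } Q(b)\neq 0.\end{cases} \] -/

import Mathlib

open scoped Pointwise

/-- The canonical additive character `x ↦ exp (2 π i Tr(x) / p)` of a finite field `F` of
characteristic `p`, where `Tr` is the absolute trace from `F` to the prime field. -/
noncomputable def canonicalAddChar (p : ℕ) [Fact p.Prime] (F : Type*) [Field F]
    [Algebra (ZMod p) F] : AddChar F ℂ :=
  (ZMod.stdAddChar (N := p)).compAddMonoidHom (Algebra.trace (ZMod p) F).toAddMonoidHom

open scoped Classical in
/-- The value `χ(D) = ∑_{x ∈ D} χ(x)` of an additive character on (the group ring element of)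
a subset `D` of a finite abelian group. -/
noncomputable def charSum {G : Type*} [AddCommGroup G] [Fintype G] (χ : AddChar G ℂ)
    (D : Set G) : ℂ :=
  ∑ x with x ∈ D, χ x

/-- The cyclotomic class `g ^ i ⟨g ^ e⟩` of order `e`, as a subset of the field. -/
def cyclotomicClass {K : Type*} [Field K] (g : Kˣ) (e i : ℕ) : Set K :=
  {x | ∃ h ∈ Subgroup.zpowers (g ^ e), x = ((g ^ i * h : Kˣ) : K)}

/-- The character `φ_b : x ↦ ψ(B(b, x))` of `(V, +)`, where `B(x, y) = Q(x + y) - Q(x) - Q(y)`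
is the polar form of `Q` and `ψ` is the canonical additive character of `F`. -/
noncomputable def polarChar (p : ℕ) [Fact p.Prime] {F V : Type*} [Field F] [Algebra (ZMod p) F]
    [AddCommGroup V] [Module F V] (Q : QuadraticForm F V) (b : V) : AddChar V ℂ :=
  (canonicalAddChar p F).compAddMonoidHom (Q.polarBilin b).toAddMonoidHom

/-- The form `x₁x₂ + x₃x₄ + ⋯ + x_{2m-1}x_{2m}` (the coordinates are numbered from `0` in the
code). -/
def hyperbolicForm (F : Type*) [Field F] (m : ℕ) : QuadraticForm F (Fin (2 * m) → F) :=
  ∑ j : Fin m, QuadraticMap.linMulLin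
    (LinearMap.proj (⟨2 * j, by omega⟩ : Fin (2 * m)))
    (LinearMap.proj (⟨2 * j + 1, by omega⟩ : Fin (2 * m)))

/-- The form `x₁x₂ + ⋯ + x_{2k-1}x_{2k} + (a x_{2k+1}² + b x_{2k+1}x_{2k+2} + c x_{2k+2}²)`
(the coordinates are numbered from `0` in the code). -/
def ellipticForm (F : Type*) [Field F] (k : ℕ) (a b c : F) :
    QuadraticForm F (Fin (2 * k + 2) → F) :=
  ∑ j : Fin k, QuadraticMap.linMulLin
      (LinearMap.proj (⟨2 * j, by omega⟩ : Fin (2 * k + 2)))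
      (LinearMap.proj (⟨2 * j + 1, by omega⟩ : Fin (2 * k + 2)))
    + (a • QuadraticMap.linMulLin
          (LinearMap.proj (⟨2 * k, by omega⟩ : Fin (2 * k + 2)))
          (LinearMap.proj (⟨2 * k, by omega⟩ : Fin (2 * k + 2)))
      + b • QuadraticMap.linMulLin
          (LinearMap.proj (⟨2 * k, by omega⟩ : Fin (2 * k + 2)))
          (LinearMap.proj (⟨2 * k + 1, by omega⟩ : Fin (2 * k + 2)))
      + c • QuadraticMap.linMulLin
          (LinearMap.proj (⟨2 * k + 1, by omega⟩ : Fin (2 * k + 2)))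
          (LinearMap.proj (⟨2 * k + 1, by omega⟩ : Fin (2 * k + 2))))

/-- `Q` is hyperbolic: equivalent to `x₁x₂ + x₃x₄ + ⋯ + x_{2m-1}x_{2m}`. -/
def IsHyperbolic {F V : Type*} [Field F] [AddCommGroup V] [Module F V]
    (Q : QuadraticForm F V) : Prop :=
  ∃ m : ℕ, QuadraticMap.Equivalent Q (hyperbolicForm F m)

open MvPolynomial in
/-- `Q` is elliptic: equivalent to `x₁x₂ + ⋯ + (a x_{n-1}² + b x_{n-1}x_n + c x_n²)`
with `a x² + b x y + c y²` irreducible over `F`. -/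
def IsElliptic {F V : Type*} [Field F] [AddCommGroup V] [Module F V]
    (Q : QuadraticForm F V) : Prop :=
  ∃ (k : ℕ) (a b c : F),
    Irreducible (C a * X 0 ^ 2 + C b * (X 0 * X 1) + C c * X 1 ^ 2 : MvPolynomial (Fin 2) F) ∧
    QuadraticMap.Equivalent Q (ellipticForm F k a b c)

/-! A nonzero isotropic vector splits off a hyperbolic plane, and by Chevalley–Warning one exists in
dimension at least 3. Induction leaves either nothing or an anisotropic plane, which is the elliptic
case.

For `t ≠ 0` the Gauss sum `∑ ψ (t * Q x)` equals `ε q ^ m`, whatever `t` is: each hyperbolic plane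
contributes `q`, and an anisotropic plane, being a scaled norm form of the quadratic extension,
contributes `-q`. Since the value does not depend on `t`, completing the square (`sum_level_set`)
turns the character sum over `Q x = c` into `ε q ^ (m - 1)` times the Kloosterman sum of `Q b` and
`c`.

The same lemma applied to the norm of `K` over `F`, with Gauss sum `-q`, writes a Kloosterman sum as
minus the sum of the trace character over a norm fibre (`sum_trace_norm_eq`). Norm preimages of
cyclotomic classes are cyclotomic classes of `K`, so summing over a class gives the stated value. -/

section Classification

variable {F : Type*} [Field F]

/-! ### Standard forms in coordinates -/

theorem hyperbolicForm_apply (m : ℕ) (x : Fin (2 * m) → F) :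
    hyperbolicForm F m x =
      ∑ j : Fin m, x ⟨2 * j, by omega⟩ * x ⟨2 * j + 1, by omega⟩ := by
  simp [hyperbolicForm]

theorem ellipticForm_apply (k : ℕ) (a b c : F) (x : Fin (2 * k + 2) → F) :
    ellipticForm F k a b c x =
      ∑ j : Fin k, x ⟨2 * j, by omega⟩ * x ⟨2 * j + 1, by omega⟩ +
      (a * (x ⟨2 * k, by omega⟩ * x ⟨2 * k, by omega⟩) +
        b * (x ⟨2 * k, by omega⟩ * x ⟨2 * k + 1, by omega⟩) +
        c * (x ⟨2 * k + 1, by omega⟩ * x ⟨2 * k + 1, by omega⟩)) := by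
  simp [ellipticForm]

/-- Prepending two coordinates to a vector. -/
def consTwoEquiv (F : Type*) [Field F] (n : ℕ) :
    (F × F × (Fin n → F)) ≃ₗ[F] (Fin (n + 2) → F) :=
  ((LinearEquiv.refl F F).prodCongr (Fin.consLinearEquiv F (fun _ : Fin (n + 1) => F))).trans
    (Fin.consLinearEquiv F (fun _ : Fin (n + 2) => F))

theorem hyperbolicForm_succ_consTwoEquiv (m : ℕ) (u : F × F × (Fin (2 * m) → F)) :
    hyperbolicForm F (m + 1) (consTwoEquiv F (2 * m) u) =
      u.1 * u.2.1 + hyperbolicForm F m u.2.2 := by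
  rw [hyperbolicForm_apply, hyperbolicForm_apply, Fin.sum_univ_succ]
  rfl

theorem ellipticForm_succ_consTwoEquiv (k : ℕ) (a b c : F)
    (u : F × F × (Fin (2 * k + 2) → F)) :
    ellipticForm F (k + 1) a b c (consTwoEquiv F (2 * k + 2) u) =
      u.1 * u.2.1 + ellipticForm F k a b c u.2.2 := by
  rw [ellipticForm_apply, ellipticForm_apply, Fin.sum_univ_succ, add_assoc]
  rfl

theorem ellipticForm_zero_consTwoEquiv (a b c : F) (u : F × F × (Fin 0 → F)) :
    ellipticForm F 0 a b c (consTwoEquiv F 0 u) =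
      a * (u.1 * u.1) + b * (u.1 * u.2.1) + c * (u.2.1 * u.2.1) := by
  rw [ellipticForm_apply, Fin.sum_univ_zero, zero_add]
  rfl

/-! ### Splitting off a hyperbolic plane -/

variable {V : Type*} [AddCommGroup V] [Module F V]

theorem QuadraticMap.map_add_smul_eq (Q : QuadraticForm F V) (x b : V) (s : F) :
    Q (x + s • b) = Q x + s * Q.polarBilin b x + s ^ 2 * Q b := by
  rw [QuadraticMap.map_add Q, QuadraticMap.polar_smul_right, QuadraticMap.polarBilin_apply_apply,
    QuadraticMap.polar_comm _ x b, QuadraticMap.map_smul, smul_eq_mul, smul_eq_mul]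
  ring

/-- An isotropic vector outside the radical is the first vector of a hyperbolic pair. -/
theorem exists_hyperbolic_pair (Q : QuadraticForm F V) (hQ : Q.radical = ⊥)
    {v : V} (hv : v ≠ 0) (hQv : Q v = 0) : ∃ w : V, Q w = 0 ∧ Q.polarBilin v w = 1 := by
  have hvv : Q.polarBilin v v = 0 := by
    simp [QuadraticMap.polarBilin_apply_apply, QuadraticMap.polar_self, hQv]
  have : ∃ w, Q.polarBilin v w ≠ 0 := by
    by_contra! h
    refine hv ((Submodule.mem_bot F).1 (hQ ▸ QuadraticMap.mem_radical_iff'.2 ⟨hQv, fun n => ?_⟩))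
    rw [QuadraticMap.map_add Q, hQv, ← QuadraticMap.polarBilin_apply_apply, h, add_zero, zero_add]
  obtain ⟨w₀, hw₀⟩ := this
  set w₁ := (Q.polarBilin v w₀)⁻¹ • w₀ with hw₁
  have h₁ : Q.polarBilin v w₁ = 1 := by
    rw [hw₁, map_smul, smul_eq_mul, inv_mul_cancel₀ hw₀]
  -- Adding `s • v` changes `Q w₁` by exactly `s` and leaves the pairing with `v` alone, so no
  -- division by 2 is needed.
  refine ⟨w₁ + (-Q w₁) • v, ?_, ?_⟩
  · rw [QuadraticMap.map_add_smul_eq, h₁, hQv]; ring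
  · rw [map_add, h₁, map_smul, hvv, smul_zero, add_zero]

/-- A nonsingular quadratic space with a nonzero isotropic vector splits off a hyperbolic plane. -/
theorem exists_equiv_plane_prod (Q : QuadraticForm F V) (hQ : Q.radical = ⊥)
    {v : V} (hv : v ≠ 0) (hQv : Q v = 0) :
    ∃ (W : Submodule F V) (E : V ≃ₗ[F] F × F × W),
      ∀ x, Q x = (E x).1 * (E x).2.1 + Q (E x).2.2 := by
  obtain ⟨w, hQw, hvw⟩ := exists_hyperbolic_pair Q hQ hv hQv
  have hvv : Q.polarBilin v v = 0 := by
    simp [QuadraticMap.polarBilin_apply_apply, QuadraticMap.polar_self, hQv]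
  have hww : Q.polarBilin w w = 0 := by
    simp [QuadraticMap.polarBilin_apply_apply, QuadraticMap.polar_self, hQw]
  have hwv : Q.polarBilin w v = 1 := by
    rw [← hvw, QuadraticMap.polarBilin_apply_apply, QuadraticMap.polarBilin_apply_apply,
      QuadraticMap.polar_comm]
  let W : Submodule F V := (Q.polarBilin v).ker ⊓ (Q.polarBilin w).ker
  have hW : ∀ u ∈ W, Q.polarBilin v u = 0 ∧ Q.polarBilin w u = 0 := fun u hu => hu
  -- Projection along the plane: as `v`, `w` are isotropic with pairing 1, the coefficient of `v` in
  -- `x` is the pairing with `w`, and conversely.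
  let P : V →ₗ[F] W :=
    (LinearMap.id - (Q.polarBilin w).smulRight v - (Q.polarBilin v).smulRight w).codRestrict W
      (fun x => by
        refine Submodule.mem_inf.2 ⟨?_, ?_⟩ <;> rw [LinearMap.mem_ker] <;>
        simp [-QuadraticMap.polarBilin_apply_apply, hvv, hww, hvw, hwv])
  have hP : ∀ x, ((P x : W) : V) = x - Q.polarBilin w x • v - Q.polarBilin v x • w :=
    fun x => rfl
  let E : V ≃ₗ[F] F × F × W :=
    { (Q.polarBilin w).prod ((Q.polarBilin v).prod P) with
      invFun := fun y => y.1 • v + y.2.1 • w + (y.2.2 : V)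
      left_inv := fun x => by
        change Q.polarBilin w x • v + Q.polarBilin v x • w + (P x : V) = x
        rw [hP]; abel
      right_inv := fun y => by
        obtain ⟨a, b, u⟩ := y
        obtain ⟨h₁, h₂⟩ := hW u u.2
        have e₁ : Q.polarBilin w (a • v + b • w + (u : V)) = a := by
          rw [map_add, map_add, map_smul, map_smul, hwv, hww, h₂]; simp
        have e₂ : Q.polarBilin v (a • v + b • w + (u : V)) = b := by
          rw [map_add, map_add, map_smul, map_smul, hvv, hvw, h₁]; simp
        refine Prod.ext e₁ (Prod.ext e₂ (Subtype.ext ?_))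
        change ((P (a • v + b • w + (u : V)) : W) : V) = u
        rw [hP, e₁, e₂]; abel }
  refine ⟨W, E, fun x => ?_⟩
  obtain ⟨y, rfl⟩ := E.symm.surjective x
  rw [E.apply_symm_apply]
  obtain ⟨a, b, u⟩ := y
  obtain ⟨h₁, h₂⟩ := hW u u.2
  change Q (a • v + b • w + (u : V)) = a * b + Q u
  rw [add_comm, ← add_assoc, QuadraticMap.map_add_smul_eq, QuadraticMap.map_add_smul_eq, map_add,
    map_smul, hwv, h₁, h₂, hQv, hQw, smul_eq_mul]
  ring

theorem radical_eq_bot_of_equiv_plane_prod (Q : QuadraticForm F V) (hQ : Q.radical = ⊥)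
    {W : Submodule F V} (E : V ≃ₗ[F] F × F × W)
    (hE : ∀ x, Q x = (E x).1 * (E x).2.1 + Q (E x).2.2) :
    QuadraticMap.radical (QuadraticMap.comp Q W.subtype) = ⊥ := by
  rw [eq_bot_iff]
  intro u hu
  obtain ⟨hu₀, hu₁⟩ := QuadraticMap.mem_radical_iff'.1 hu
  have hmem : E.symm (0, 0, u) ∈ Q.radical := by
    refine QuadraticMap.mem_radical_iff'.2 ⟨?_, fun n => ?_⟩
    · rw [hE, E.apply_symm_apply]
      simpa using hu₀
    · rw [hE, hE n, map_add, E.apply_symm_apply]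
      simpa using hu₁ (E n).2.2
  rw [hQ, Submodule.mem_bot, LinearEquiv.map_eq_zero_iff] at hmem
  simpa using hmem

/-! ### Irreducible binary forms and Chevalley–Warning -/

open MvPolynomial

/-- The binary quadratic form `a x² + b x y + c y²` as a polynomial. -/
noncomputable abbrev binaryPolynomial (a b c : F) : MvPolynomial (Fin 2) F :=
  C a * X 0 ^ 2 + C b * (X 0 * X 1) + C c * X 1 ^ 2

/-- A nontrivial zero yields a factorization into two factors vanishing at the origin, so neither is
a unit. -/
theorem anisotropic_of_irreducible_binaryPolynomial (a b c : F)
    (h : Irreducible (binaryPolynomial a b c)) (x y : F)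
    (hxy : a * (x * x) + b * (x * y) + c * (y * y) = 0) : x = 0 ∧ y = 0 := by
  have hnu : ∀ g : MvPolynomial (Fin 2) F, eval 0 g = 0 → ¬ IsUnit g := fun g hg hu => by
    have := hu.map (eval (0 : Fin 2 → F))
    rw [hg] at this
    exact not_isUnit_zero this
  have hfac : ∀ g k : MvPolynomial (Fin 2) F, eval 0 g = 0 → eval 0 k = 0 →
      binaryPolynomial a b c ≠ g * k := fun g k hg hk he =>
    (h.isUnit_or_isUnit he).elim (hnu g hg) (hnu k hk)
  have hy : y = 0 := by
    by_contra hy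
    set r := x / y with hr
    have hc : c = -r * (b + a * r) := by
      rw [hr]; field_simp; linear_combination hxy
    refine hfac (X 0 - C r * X 1) (C a * X 0 + C (b + a * r) * X 1) (by simp) (by simp) ?_
    simp only [binaryPolynomial, hc, map_add, map_mul, map_neg]
    ring
  refine ⟨?_, hy⟩
  by_contra hx
  have ha : a = 0 := by simpa [hy, hx] using hxy
  refine hfac (X 1) (C b * X 0 + C c * X 1) (by simp) (by simp) ?_
  simp only [binaryPolynomial, ha, map_zero]
  ring

variable [Fintype F]

/-- A polynomial of degree less than the number of variables which vanishes at the origin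
has another zero. -/
theorem exists_ne_zero_eval_eq_zero {σ : Type*} [Fintype σ] (f : MvPolynomial σ F)
    (hf : f.totalDegree < Fintype.card σ) (h0 : eval 0 f = 0) :
    ∃ x : σ → F, x ≠ 0 ∧ eval x f = 0 := by
  classical
  obtain ⟨p, hp⟩ := CharP.exists F
  -- Chevalley–Warning: the characteristic divides the number of zeros, so the origin cannot be the
  -- only one.
  have hdvd := char_dvd_card_solutions p hf
  by_contra! h
  have : Fintype.card { x : σ → F // eval x f = 0 } = 1 := by
    rw [Fintype.card_eq_one_iff]
    refine ⟨⟨0, h0⟩, fun y => Subtype.ext ?_⟩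
    by_contra hy
    exact h y hy y.2
  rw [this, Nat.dvd_one] at hdvd
  exact CharP.char_ne_one F p hdvd

theorem exists_isotropic [FiniteDimensional F V] (Q : QuadraticForm F V)
    (hV : 3 ≤ Module.finrank F V) : ∃ v ≠ 0, Q v = 0 := by
  -- `β` need not be symmetric, so this also works in characteristic 2.
  obtain ⟨β, rfl⟩ := LinearMap.BilinMap.toQuadraticMap_surjective Q
  let B := Module.finBasis F V
  let f : MvPolynomial (Fin (Module.finrank F V)) F :=
    ∑ i, ∑ j, X i * X j * C (β (B i) (B j))
  have hdeg : f.totalDegree ≤ 2 := by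
    refine (IsHomogeneous.totalDegree_le (n := 2) ?_)
    refine IsHomogeneous.sum _ _ _ fun i _ => IsHomogeneous.sum _ _ _ fun j _ => ?_
    exact ((isHomogeneous_X F i).mul (isHomogeneous_X F j)).mul (isHomogeneous_C _ _)
  have heval : ∀ x, eval x f = β (B.equivFun.symm x) (B.equivFun.symm x) := by
    intro x
    simp only [f, map_sum, map_mul, eval_X, eval_C, Module.Basis.equivFun_symm_apply,
      LinearMap.sum_apply, LinearMap.smul_apply, map_smul, smul_eq_mul, Finset.mul_sum]
    rw [Finset.sum_comm]
    refine Finset.sum_congr rfl fun i _ => ?_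
    refine Finset.sum_congr rfl fun j _ => ?_
    ring
  obtain ⟨x, hx, hx0⟩ := exists_ne_zero_eval_eq_zero f (by rw [Fintype.card_fin]; omega)
    (by rw [heval, LinearEquiv.map_zero, map_zero])
  refine ⟨B.equivFun.symm x, (LinearEquiv.map_ne_zero_iff _).2 hx, ?_⟩
  rw [LinearMap.BilinMap.toQuadraticMap_apply, ← heval, hx0]

/-- In a proper factorization both factors have degree 1, and one of them vanishes at the origin.
Having fewer degrees than variables, it has a second zero, which is a nontrivial zero of the form.
-/
theorem irreducible_binaryPolynomial_of_anisotropic (a b c : F)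
    (h : ∀ x y : F, a * (x * x) + b * (x * y) + c * (y * y) = 0 → x = 0 ∧ y = 0) :
    Irreducible (binaryPolynomial a b c) := by
  have heval : ∀ z, eval z (binaryPolynomial a b c) =
      a * (z 0 * z 0) + b * (z 0 * z 1) + c * (z 1 * z 1) := fun z => by
    simp [binaryPolynomial]; ring
  have hdeg : (binaryPolynomial a b c).totalDegree ≤ 2 := by
    refine (IsHomogeneous.totalDegree_le (n := 2) ?_)
    refine ((IsHomogeneous.add ?_ ?_).add ?_)
    · exact ((isHomogeneous_X F (0 : Fin 2)).pow 2).C_mul a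
    · exact ((isHomogeneous_X F (0 : Fin 2)).mul (isHomogeneous_X F 1)).C_mul b
    · exact ((isHomogeneous_X F (1 : Fin 2)).pow 2).C_mul c
  have hne : binaryPolynomial a b c ≠ 0 := fun h0 => by
    have := heval ![1, 0]
    rw [h0, map_zero] at this
    exact one_ne_zero (h 1 0 (by simpa using this.symm)).1
  have hunit : ∀ g : MvPolynomial (Fin 2) F, g ≠ 0 → g.totalDegree = 0 → IsUnit g := by
    intro g hg hg0
    rw [totalDegree_eq_zero_iff_eq_C] at hg0
    rw [hg0]
    refine (isUnit_iff_ne_zero.2 fun h0 => hg ?_).map C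
    rw [hg0, h0, C_0]
  refine ⟨fun hu => ?_, fun g k hgk => ?_⟩
  · have := hu.map (eval (0 : Fin 2 → F))
    rw [heval] at this
    simp at this
  · have hg : g ≠ 0 := fun h0 => hne (by rw [hgk, h0, zero_mul])
    have hk : k ≠ 0 := fun h0 => hne (by rw [hgk, h0, mul_zero])
    by_contra! hcon
    have hg1 : g.totalDegree ≠ 0 := fun h0 => hcon.1 (hunit g hg h0)
    have hk1 : k.totalDegree ≠ 0 := fun h0 => hcon.2 (hunit k hk h0)
    rw [hgk, totalDegree_mul_of_isDomain hg hk] at hdeg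
    have key : ∀ l : MvPolynomial (Fin 2) F, l.totalDegree < 2 → l ∣ binaryPolynomial a b c →
        eval 0 l ≠ 0 := by
      intro l hl hdvd h0
      obtain ⟨x, hx, hx0⟩ := exists_ne_zero_eval_eq_zero l (by simpa using hl) h0
      have h1 : eval x (binaryPolynomial a b c) = 0 := by
        obtain ⟨l', hl'⟩ := hdvd
        rw [hl', map_mul, hx0, zero_mul]
      rw [heval] at h1
      obtain ⟨h2, h3⟩ := h _ _ h1
      exact hx (funext fun i => by fin_cases i <;> assumption)
    have h0 := heval 0
    rw [hgk, map_mul] at h0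
    simp only [Pi.zero_apply, mul_zero, add_zero, mul_eq_zero] at h0
    rcases h0 with h0 | h0
    · exact key g (by omega) ⟨k, hgk⟩ h0
    · exact key k (by omega) ⟨g, by rw [hgk, mul_comm]⟩ h0

end Classification

/-! ### Classification by induction on the dimension -/

section Decomposition

variable {F : Type*} [Field F] {V : Type*} [AddCommGroup V] [Module F V]

theorem equivalent_hyperbolicForm_succ (Q : QuadraticForm F V) {W : Submodule F V}
    (E : V ≃ₗ[F] F × F × W) (hE : ∀ x, Q x = (E x).1 * (E x).2.1 + Q (E x).2.2) {m : ℕ}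
    (h : QuadraticMap.Equivalent (QuadraticMap.comp Q W.subtype) (hyperbolicForm F m)) :
    QuadraticMap.Equivalent Q (hyperbolicForm F (m + 1)) := by
  obtain ⟨f⟩ := h
  refine ⟨⟨(E.trans ((LinearEquiv.refl F F).prodCongr
    ((LinearEquiv.refl F F).prodCongr f.toLinearEquiv))).trans
      (consTwoEquiv F (2 * m)), fun x => ?_⟩⟩
  refine (hyperbolicForm_succ_consTwoEquiv m _).trans ?_
  rw [hE x]
  exact congrArg _ (f.map_app _)

theorem equivalent_ellipticForm_succ (Q : QuadraticForm F V) {W : Submodule F V}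
    (E : V ≃ₗ[F] F × F × W) (hE : ∀ x, Q x = (E x).1 * (E x).2.1 + Q (E x).2.2) {k : ℕ}
    {a b c : F}
    (h : QuadraticMap.Equivalent (QuadraticMap.comp Q W.subtype) (ellipticForm F k a b c)) :
    QuadraticMap.Equivalent Q (ellipticForm F (k + 1) a b c) := by
  obtain ⟨f⟩ := h
  refine ⟨⟨(E.trans ((LinearEquiv.refl F F).prodCongr
    ((LinearEquiv.refl F F).prodCongr f.toLinearEquiv))).trans
      (consTwoEquiv F (2 * k + 2)), fun x => ?_⟩⟩
  refine (ellipticForm_succ_consTwoEquiv k a b c _).trans ?_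
  rw [hE x]
  exact congrArg _ (f.map_app _)

variable [Fintype F]

theorem equivalent_ellipticForm_zero (Q : QuadraticForm F V) (hV : Module.finrank F V = 2)
    (hQ : ∀ v, Q v = 0 → v = 0) :
    ∃ a b c : F, Irreducible (binaryPolynomial a b c) ∧
      QuadraticMap.Equivalent Q (ellipticForm F 0 a b c) := by
  have : FiniteDimensional F V := FiniteDimensional.of_finrank_eq_succ hV
  let B := Module.finBasisOfFinrankEq F V hV
  have hform : ∀ v, ellipticForm F 0 (Q (B 0)) (Q.polarBilin (B 1) (B 0)) (Q (B 1))
      (B.equivFun v) = Q v := by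
    intro v
    conv_rhs => rw [← B.equivFun.symm_apply_apply v, Module.Basis.equivFun_symm_apply,
      Fin.sum_univ_two, QuadraticMap.map_add_smul_eq, QuadraticMap.map_smul Q,
      map_smul]
    rw [ellipticForm_apply, Fin.sum_univ_zero, zero_add]
    simp only [smul_eq_mul]
    change _ * (B.equivFun v 0 * B.equivFun v 0) + _ * (B.equivFun v 0 * B.equivFun v 1)
      + _ * (B.equivFun v 1 * B.equivFun v 1) = _
    ring
  refine ⟨_, _, _, irreducible_binaryPolynomial_of_anisotropic _ _ _ fun x y hxy => ?_,
    ⟨⟨B.equivFun, hform⟩⟩⟩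
  have h0 : Q (B.equivFun.symm ![x, y]) = 0 := by
    rw [← hform, B.equivFun.apply_symm_apply, ellipticForm_apply, Fin.sum_univ_zero, zero_add]
    exact hxy
  have h1 := (LinearEquiv.map_eq_zero_iff _).1 (hQ _ h0)
  exact ⟨congrFun h1 0, congrFun h1 1⟩

/-- The space is quantified after `m` so that the induction hypothesis applies to the complement of
a hyperbolic plane. -/
theorem equivalent_hyperbolicForm_or_ellipticForm (m : ℕ) :
    ∀ {V : Type*} [AddCommGroup V] [Module F V] (Q : QuadraticForm F V),
      Module.Finite F V → Module.finrank F V = 2 * m → Q.radical = ⊥ →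
      QuadraticMap.Equivalent Q (hyperbolicForm F m) ∨
      ∃ (k : ℕ) (a b c : F), Irreducible (binaryPolynomial a b c) ∧
        QuadraticMap.Equivalent Q (ellipticForm F k a b c) := by
  induction m with
  | zero =>
    intro V _ _ Q _ hV _
    have : Subsingleton V := Module.finrank_zero_iff.1 hV
    refine Or.inl ⟨⟨LinearEquiv.ofFinrankEq _ _ (by simpa using hV), fun x => ?_⟩⟩
    change hyperbolicForm F 0 _ = _
    rw [hyperbolicForm_apply, Fin.sum_univ_zero, Subsingleton.elim x 0, QuadraticMap.map_zero]
  | succ m ih =>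
    intro V _ _ Q _ hV hQ
    by_cases h : ∃ v ≠ 0, Q v = 0
    · obtain ⟨v, hv, hQv⟩ := h
      obtain ⟨W, E, hE⟩ := exists_equiv_plane_prod Q hQ hv hQv
      have hW : Module.finrank F W = 2 * m := by
        have := E.finrank_eq
        rw [Module.finrank_prod, Module.finrank_prod, Module.finrank_self] at this
        omega
      rcases ih (QuadraticMap.comp Q W.subtype) inferInstance hW
        (radical_eq_bot_of_equiv_plane_prod Q hQ E hE) with h | ⟨k, a, b, c, hirr, h⟩
      · exact Or.inl (equivalent_hyperbolicForm_succ Q E hE h)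
      · exact Or.inr ⟨k + 1, a, b, c, hirr, equivalent_ellipticForm_succ Q E hE h⟩
    · have hm : m = 0 := by
        by_contra hm
        exact h (exists_isotropic Q (by omega))
      subst hm
      push Not at h
      obtain ⟨a, b, c, hirr, h⟩ := equivalent_ellipticForm_zero Q hV
        fun v hv => by_contra fun hne => h v hne hv
      exact Or.inr ⟨0, a, b, c, hirr, h⟩

end Decomposition

/-! ### Gauss sums and level sets -/

section GaussSums

variable {F : Type*} [Field F]

theorem sum_comp_of_equivalent {V V' : Type*} [AddCommGroup V] [Module F V] [Fintype V]
    [AddCommGroup V'] [Module F V'] [Fintype V'] {Q : QuadraticForm F V} {Q' : QuadraticForm F V'}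
    (h : QuadraticMap.Equivalent Q Q') (f : F → ℂ) : ∑ x, f (Q x) = ∑ x, f (Q' x) := by
  obtain ⟨e⟩ := h
  rw [← e.toLinearEquiv.toEquiv.sum_comp]
  exact Finset.sum_congr rfl fun x _ => congrArg f (e.map_app x).symm

/-- The polar form is nondegenerate once the Gauss sums do not vanish and the radical is zero. -/
theorem exists_polarBilin_ne_zero {V : Type*} [AddCommGroup V] [Module F V] [Fintype V]
    {ψ : AddChar F ℂ} (hψ : ψ.IsPrimitive) (Q : QuadraticForm F V) (hQ : Q.radical = ⊥) {g : ℂ}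
    (hg0 : g ≠ 0) (hg : ∀ t : F, t ≠ 0 → ∑ x, ψ (t * Q x) = g) {b : V} (hb : b ≠ 0) :
    ∃ x, Q.polarBilin b x ≠ 0 := by
  by_contra! h
  have hadd : ∀ x, Q (x + b) = Q x + Q b := fun x => by
    have := QuadraticMap.map_add_smul_eq Q x b 1
    rwa [one_smul, h, one_pow, one_mul, one_mul, add_zero] at this
  -- Translating by `b` multiplies the Gauss sum at `t` by `ψ (t * Q b)`. As the sum is nonzero,
  -- this factor is 1 for every `t`, against primitivity if `Q b ≠ 0`.
  have hQb : Q b = 0 := by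
    by_contra hQb
    refine hψ hQb (DFunLike.ext _ _ fun t => ?_)
    rw [AddChar.mulShift_apply, AddChar.one_apply, mul_comm]
    rcases eq_or_ne t 0 with rfl | ht
    · simp
    have h1 := hg t ht
    rw [← Equiv.sum_comp (Equiv.addRight b)] at h1
    simp only [Equiv.coe_addRight, hadd, mul_add, AddChar.map_add_eq_mul] at h1
    rw [← Finset.sum_mul, hg t ht] at h1
    exact mul_left_cancel₀ hg0 (h1.trans (mul_one g).symm)
  refine hb ((Submodule.mem_bot F).1 (hQ ▸ QuadraticMap.mem_radical_iff'.2 ⟨hQb, fun n => ?_⟩))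
  rw [add_comm, hadd, hQb, add_zero]

variable [Fintype F]

theorem sum_mul_char_eq_zero {ψ : AddChar F ℂ} (hψ : ψ.IsPrimitive) {b : F} (hb : b ≠ 0) :
    ∑ x, ψ (x * b) = 0 := by
  classical
  rw [AddChar.sum_mulShift b hψ, if_neg hb, Nat.cast_zero]

theorem sum_units_char [DecidableEq F] {ψ : AddChar F ℂ} (hψ : ψ.IsPrimitive) {b : F}
    (hb : b ≠ 0) :
    ∑ t : Fˣ, ψ (t * b) = -1 := by
  have h := sum_mul_char_eq_zero hψ hb
  rw [← Finset.add_sum_erase _ _ (Finset.mem_univ (0 : F)), zero_mul, AddChar.map_zero_eq_one]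
    at h
  have h2 : ∑ x ∈ Finset.univ.erase (0 : F), ψ (x * b) = ∑ t : Fˣ, ψ (t * b) := by
    refine (Finset.sum_bij (fun (t : Fˣ) _ => (t : F)) ?_ ?_ ?_ ?_).symm
    · intro t _; simp
    · intro t _ t' _ h; exact Units.ext h
    · intro x hx; exact ⟨Units.mk0 x (by simpa using hx), Finset.mem_univ _, rfl⟩
    · intro t _; rfl
  rw [h2] at h
  linear_combination h

theorem sum_plane {ψ : AddChar F ℂ} (hψ : ψ.IsPrimitive) {t : F} (ht : t ≠ 0) :
    ∑ x : F, ∑ y : F, ψ (t * (x * y)) = Fintype.card F := by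
  classical
  have h : ∀ x : F, ∑ y : F, ψ (t * (x * y)) = if x = 0 then (Fintype.card F : ℂ) else 0 := by
    intro x
    have : ∀ y, t * (x * y) = y * (t * x) := fun y => by ring
    simp only [this]
    rw [AddChar.sum_mulShift _ hψ]
    simp [ht]
  simp only [h, Finset.sum_ite_eq', Finset.mem_univ, if_true]

theorem sum_consTwoEquiv {n : ℕ} (ψ : AddChar F ℂ) (t : F) (f : (Fin (n + 2) → F) → F)
    (g : (Fin n → F) → F)
    (h : ∀ u, f (consTwoEquiv F n u) = u.1 * u.2.1 + g u.2.2) :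
    ∑ x, ψ (t * f x) = (∑ x, ∑ y, ψ (t * (x * y))) * ∑ z, ψ (t * g z) := by
  rw [← (consTwoEquiv F n).toEquiv.sum_comp, Fintype.sum_prod_type, Finset.sum_mul]
  refine Finset.sum_congr rfl fun x _ => ?_
  rw [Fintype.sum_prod_type, Finset.sum_mul]
  refine Finset.sum_congr rfl fun y _ => ?_
  rw [Finset.mul_sum]
  refine Finset.sum_congr rfl fun z _ => ?_
  rw [← AddChar.map_add_eq_mul, ← mul_add]
  exact congrArg (fun s => ψ (t * s)) (h (x, y, z))

theorem sum_hyperbolicForm {ψ : AddChar F ℂ} (hψ : ψ.IsPrimitive) {t : F} (ht : t ≠ 0) (m : ℕ) :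
    ∑ x, ψ (t * hyperbolicForm F m x) = (Fintype.card F : ℂ) ^ m := by
  induction m with
  | zero => simp only [hyperbolicForm_apply]; simp
  | succ m ih =>
    refine (sum_consTwoEquiv (n := 2 * m) ψ t (hyperbolicForm F (m + 1)) (hyperbolicForm F m)
      (hyperbolicForm_succ_consTwoEquiv m)).trans ?_
    rw [ih, sum_plane hψ ht, pow_succ']

theorem sum_ellipticForm {ψ : AddChar F ℂ} (hψ : ψ.IsPrimitive) {t : F} (ht : t ≠ 0)
    {a b c : F} {g : ℂ}
    (hg : ∑ x, ∑ y, ψ (t * (a * (x * x) + b * (x * y) + c * (y * y))) = g) (k : ℕ) :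
    ∑ x, ψ (t * ellipticForm F k a b c x) = (Fintype.card F : ℂ) ^ k * g := by
  induction k with
  | zero =>
    rw [pow_zero, one_mul, ← hg, ← (consTwoEquiv F 0).toEquiv.sum_comp, Fintype.sum_prod_type]
    refine Finset.sum_congr rfl fun x _ => ?_
    rw [Fintype.sum_prod_type]
    refine Finset.sum_congr rfl fun y _ => ?_
    rw [Fintype.sum_unique]
    exact congrArg (fun s => ψ (t * s)) (ellipticForm_zero_consTwoEquiv a b c _)
  | succ k ih =>
    refine (sum_consTwoEquiv (n := 2 * k + 2) ψ t (ellipticForm F (k + 1) a b c)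
      (ellipticForm F k a b c) (ellipticForm_succ_consTwoEquiv k a b c)).trans ?_
    rw [ih, sum_plane hψ ht, pow_succ']
    ring

/-- The value at an additive character of a level set of a quadratic function, in terms of
Kloosterman sums. -/
theorem sum_level_set {V : Type*} [AddCommGroup V] [Module F V] [Fintype V]
    [DecidableEq F] {ψ : AddChar F ℂ} (hψ : ψ.IsPrimitive) {f L : V → F} {b : V}
    (hf : ∀ x s, f (x + s • b) = f x + s * L x + s ^ 2 * f b)
    (hL : ∑ x, ψ (L x) = 0) {g : ℂ} (hg : ∀ t : F, t ≠ 0 → ∑ x, ψ (t * f x) = g) (c : F) :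
    (Fintype.card F : ℂ) * ∑ x with f x = c, ψ (L x) =
      g * ∑ t : Fˣ, ψ (-((t : F)⁻¹ * f b) - t * c) := by
  -- Completing the square: the shift `x ↦ x + t⁻¹ • b` absorbs the linear term `L x` at the cost of
  -- the constant `t⁻¹ * f b`.
  have hsq : ∀ t : Fˣ, ∑ x, ψ (t * (f x - c)) * ψ (L x) =
      g * ψ (-((t : F)⁻¹ * f b) - t * c) := by
    intro t
    have ht : (t : F) ≠ 0 := t.ne_zero
    rw [← hg t ht, ← Equiv.sum_comp (Equiv.addRight ((t : F)⁻¹ • b)) (fun x => ψ (t * f x)),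
      Finset.sum_mul]
    refine Finset.sum_congr rfl fun x _ => ?_
    rw [← AddChar.map_add_eq_mul, ← AddChar.map_add_eq_mul, Equiv.coe_addRight, hf]
    congr 1
    field_simp
    ring
  have hzero : ∑ x, ψ ((0 : F) * (f x - c)) * ψ (L x) = 0 := by simpa using hL
  have hall : ∑ t : F, ∑ x, ψ (t * (f x - c)) * ψ (L x) =
      ∑ t : Fˣ, ∑ x, ψ (t * (f x - c)) * ψ (L x) := by
    rw [← Finset.add_sum_erase _ _ (Finset.mem_univ (0 : F)), hzero, zero_add]
    refine (Finset.sum_bij (fun (t : Fˣ) _ => (t : F)) ?_ ?_ ?_ ?_).symm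
    · intro t _; simp
    · intro t _ t' _ h; exact Units.ext h
    · intro x hx; exact ⟨Units.mk0 x (by simpa using hx), Finset.mem_univ _, rfl⟩
    · intro t _; rfl
  rw [Finset.mul_sum Finset.univ _ g]
  simp only [← hsq]
  -- Orthogonality: summing over all `t` in `F` detects `f x = c`.
  rw [← hall, Finset.sum_comm, Finset.sum_filter, Finset.mul_sum]
  refine Finset.sum_congr rfl fun x _ => ?_
  rw [← Finset.sum_mul, AddChar.sum_mulShift _ hψ]
  simp only [sub_eq_zero]
  split_ifs <;> simp

end GaussSums

/-! ### The norm form of the quadratic extension -/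

section NormForm

variable {F K : Type*} [Field F] [Field K] [Algebra F K]

theorem algebraMap_add_mul_pow_card [Finite F] (x y : F) (z : K) :
    (algebraMap F K x + algebraMap F K y * z) ^ Nat.card F =
      algebraMap F K x + algebraMap F K y * z ^ Nat.card F := by
  have := Fintype.ofFinite F
  have h := FiniteField.coe_frobeniusAlgHom F K
  rw [← Fintype.card_eq_nat_card]
  have h' : ∀ w : K, w ^ Fintype.card F = FiniteField.frobeniusAlgHom F K w := fun w => by rw [h]
  rw [h', h', map_add, map_mul, AlgHom.commutes, AlgHom.commutes]

variable [Fintype K]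

theorem algebraMap_norm_eq_mul_pow (h2 : Module.finrank F K = 2) (z : K) :
    algebraMap F K (Algebra.norm F z) = z * z ^ Nat.card F := by
  rw [FiniteField.algebraMap_norm_eq_prod_pow, h2, Finset.prod_range_succ, Finset.prod_range_one]
  simp

theorem algebraMap_trace_eq_add_pow (h2 : Module.finrank F K = 2) (z : K) :
    algebraMap F K (Algebra.trace F K z) = z + z ^ Nat.card F := by
  rw [FiniteField.algebraMap_trace_eq_sum_pow, h2, Finset.sum_range_succ, Finset.sum_range_one]
  simp

theorem norm_algebraMap_add_mul [Finite F] (h2 : Module.finrank F K = 2) (x y : F) (z : K) :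
    Algebra.norm F (algebraMap F K x + algebraMap F K y * z) =
      x * x + Algebra.trace F K z * (x * y) + Algebra.norm F z * (y * y) := by
  apply (algebraMap F K).injective
  simp only [map_add, map_mul, algebraMap_norm_eq_mul_pow h2, algebraMap_trace_eq_add_pow h2,
    algebraMap_add_mul_pow_card]
  ring

/-- This is the quadratic expansion required by `sum_level_set`, with `b = 1` and the trace as
linear part. -/
theorem norm_add_smul_one [Finite F] (h2 : Module.finrank F K = 2) (z : K) (s : F) :
    Algebra.norm F (z + s • (1 : K)) =
      Algebra.norm F z + s * Algebra.trace F K z + s ^ 2 * Algebra.norm F (1 : K) := by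
  have h := norm_algebraMap_add_mul h2 s 1 z
  rw [map_one, one_mul] at h
  rw [← Algebra.algebraMap_eq_smul_one, add_comm z, h, map_one]
  ring

/-- An anisotropic monic binary form over a finite field is a norm form. -/
theorem exists_trace_norm_eq (h2 : Module.finrank F K = 2) {b c : F}
    (h : ∀ x : F, x * x + b * x + c ≠ 0) :
    ∃ θ : K, Algebra.trace F K θ = -b ∧ Algebra.norm F θ = c ∧
      ∀ x, algebraMap F K x ≠ θ := by
  open Polynomial in
  let P : F[X] := X ^ 2 + C b * X + C c
  have hdeg : P.natDegree = 2 := by simp only [P]; compute_degree!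
  have hmonic : P.Monic := by simp only [P]; monicity!
  have hirr : Irreducible P := by
    rw [Polynomial.irreducible_iff_roots_eq_zero_of_degree_le_three (by omega) (by omega)]
    refine Multiset.eq_zero_of_forall_notMem fun x hx => h x ?_
    have := (Polynomial.mem_roots'.1 hx).2
    simp only [P, Polynomial.IsRoot.def, Polynomial.eval_add, Polynomial.eval_mul,
      Polynomial.eval_pow, Polynomial.eval_X, Polynomial.eval_C] at this
    linear_combination this
  have : Fact (Irreducible P) := ⟨hirr⟩
  obtain ⟨i⟩ := FiniteField.nonempty_algHom_of_finrank_dvd (F := F) (K := AdjoinRoot P) (L := K)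
    (by rw [(AdjoinRoot.powerBasis hirr.ne_zero).finrank, AdjoinRoot.powerBasis_dim, hdeg, h2])
  set θ := i (AdjoinRoot.root P) with hθ
  have hroot : θ ^ 2 + algebraMap F K b * θ + algebraMap F K c = 0 := by
    have h0 : Polynomial.aeval θ P = 0 := by
      rw [hθ, Polynomial.aeval_algHom_apply, AdjoinRoot.aeval_eq, AdjoinRoot.mk_self, map_zero]
    simpa [P] using h0
  have hnot : ∀ x, algebraMap F K x ≠ θ := by
    intro x hx
    refine h x ((algebraMap F K).injective ?_)
    rw [← hx] at hroot
    simp only [map_add, map_mul, map_zero]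
    linear_combination hroot
  have hchar : θ ^ 2 - algebraMap F K (Algebra.trace F K θ) * θ +
      algebraMap F K (Algebra.norm F θ) = 0 := by
    rw [algebraMap_norm_eq_mul_pow h2, algebraMap_trace_eq_add_pow h2]
    ring
  -- `θ` is a root of two monic quadratics over `F`. Their difference is linear and `θ` is not in
  -- `F`, so the coefficients agree.
  have hlin : algebraMap F K (b + Algebra.trace F K θ) * θ =
      algebraMap F K (Algebra.norm F θ - c) := by
    rw [map_add, map_sub]
    linear_combination hroot - hchar
  have htr : b + Algebra.trace F K θ = 0 := by
    by_contra hne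
    refine hnot ((b + Algebra.trace F K θ)⁻¹ * (Algebra.norm F θ - c)) ?_
    rw [map_mul, ← hlin, ← mul_assoc, ← map_mul, inv_mul_cancel₀ hne, map_one, one_mul]
  refine ⟨θ, by linear_combination htr, ?_, hnot⟩
  rw [htr, map_zero, zero_mul] at hlin
  have := (algebraMap F K).injective (hlin.symm.trans (map_zero _).symm)
  linear_combination this

variable [Fintype F] [DecidableEq F] [DecidableEq K]

/-- The norm is a surjective homomorphism on units, so its fibres have equal size; counting gives
`(q ^ 2 - 1) / (q - 1) = q + 1`. -/
theorem sum_units_norm (h2 : Module.finrank F K = 2) (f : Fˣ → ℂ) :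
    ∑ z : Kˣ, f (Units.map (Algebra.norm F (S := K)) z) =
      (Fintype.card F + 1) * ∑ u, f u := by
  set φ : Kˣ →* Fˣ := Units.map (Algebra.norm F (S := K)) with hφ
  have hsurj : Function.Surjective φ := FiniteField.unitsMap_norm_surjective F K
  have hcard : ∀ u : Fˣ, (Finset.univ.filter fun z => φ z = u).card =
      (Finset.univ.filter fun z => φ z = 1).card := fun u =>
    MonoidHom.card_fiber_eq_of_mem_range φ (hsurj u) (hsurj 1)
  set n := (Finset.univ.filter fun z => φ z = 1).card with hn
  have hsum : ∀ g : Fˣ → ℂ, ∑ z, g (φ z) = n * ∑ u, g u := by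
    intro g
    rw [← Finset.sum_fiberwise Finset.univ φ, Finset.mul_sum]
    refine Finset.sum_congr rfl fun u _ => ?_
    rw [← hcard u, ← nsmul_eq_mul, ← Finset.sum_const]
    exact Finset.sum_congr rfl fun z hz => by rw [(Finset.mem_filter.1 hz).2]
  have hK : Fintype.card K = Fintype.card F ^ 2 := by
    rw [Module.card_eq_pow_finrank (K := F) (V := K), h2]
  have h1 := hsum fun _ => 1
  have hF1 : 1 < Fintype.card F := Fintype.one_lt_card
  simp only [Finset.sum_const, Finset.card_univ, Fintype.card_units, hK, nsmul_eq_mul, mul_one]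
    at h1
  rw [Nat.cast_sub (Nat.one_le_pow _ _ (by omega)), Nat.cast_sub (by omega), Nat.cast_pow,
    Nat.cast_one] at h1
  have hne : (Fintype.card F : ℂ) - 1 ≠ 0 := by
    rw [sub_ne_zero]
    exact_mod_cast hF1.ne'
  have hnq : (n : ℂ) = Fintype.card F + 1 :=
    mul_right_cancel₀ hne (by linear_combination -h1)
  rw [hsum, hnq]

/-- Zero contributes 1 and the units contribute `-(q + 1)`. -/
theorem sum_norm {ψ : AddChar F ℂ} (hψ : ψ.IsPrimitive) (h2 : Module.finrank F K = 2) {t : F}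
    (ht : t ≠ 0) : ∑ z : K, ψ (t * Algebra.norm F z) = -(Fintype.card F : ℂ) := by
  rw [← Finset.add_sum_erase _ _ (Finset.mem_univ (0 : K))]
  have h : ∑ z ∈ Finset.univ.erase (0 : K), ψ (t * Algebra.norm F z) =
      ∑ z : Kˣ, ψ ((Units.map (Algebra.norm F (S := K)) z : Fˣ) * t) := by
    refine (Finset.sum_bij (fun (z : Kˣ) _ => (z : K)) ?_ ?_ ?_ ?_).symm
    · intro t _; simp
    · intro t _ t' _ h; exact Units.ext h
    · intro x hx; exact ⟨Units.mk0 x (by simpa using hx), Finset.mem_univ _, rfl⟩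
    · intro z _; rw [mul_comm]; rfl
  rw [h, sum_units_norm h2 fun u => ψ (u * t), sum_units_char hψ ht, Algebra.norm_zero, mul_zero,
    AddChar.map_zero_eq_one]
  ring

theorem sum_anisotropic_binary {ψ : AddChar F ℂ} (hψ : ψ.IsPrimitive)
    (h2 : Module.finrank F K = 2) {a b c : F}
    (h : ∀ x y : F, a * (x * x) + b * (x * y) + c * (y * y) = 0 → x = 0 ∧ y = 0)
    {t : F} (ht : t ≠ 0) :
    ∑ x, ∑ y, ψ (t * (a * (x * x) + b * (x * y) + c * (y * y))) = -(Fintype.card F : ℂ) := by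
  have ha : a ≠ 0 := fun ha => one_ne_zero (h 1 0 (by simp [ha])).1
  -- The sign makes the trace of `θ` equal to `b / a`, so that the form is `a` times the norm of `x
  -- + y θ`.
  obtain ⟨θ, htr, hnorm, hθ⟩ := exists_trace_norm_eq (K := K) h2 (b := -(b / a)) (c := c / a)
    (fun x hx => one_ne_zero (h (-x) 1 (by field_simp at hx; linear_combination hx)).2)
  let j : F × F → K := fun u => algebraMap F K u.1 + algebraMap F K u.2 * θ
  have hinj : Function.Injective j := by
    rintro ⟨x, y⟩ ⟨x', y'⟩ he
    change algebraMap F K x + algebraMap F K y * θ = algebraMap F K x' + algebraMap F K y' * θ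
      at he
    have hlin : algebraMap F K (y - y') * θ = algebraMap F K (x' - x) := by
      rw [map_sub, map_sub]
      linear_combination he
    have hy : y - y' = 0 := by
      by_contra hne
      refine hθ ((y - y')⁻¹ * (x' - x)) ?_
      rw [map_mul, ← hlin, ← mul_assoc, ← map_mul, inv_mul_cancel₀ hne, map_one, one_mul]
    rw [hy, map_zero, zero_mul] at hlin
    have hx := (algebraMap F K).injective (hlin.symm.trans (map_zero _).symm)
    exact Prod.ext (sub_eq_zero.1 hx).symm (sub_eq_zero.1 hy)
  have hbij : Function.Bijective j := by
    refine (Fintype.bijective_iff_injective_and_card j).2 ⟨hinj, ?_⟩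
    rw [Fintype.card_prod, Module.card_eq_pow_finrank (K := F) (V := K), h2, sq]
  rw [← sum_norm (K := K) hψ h2 (mul_ne_zero ht ha), ← hbij.sum_comp, Fintype.sum_prod_type]
  refine Finset.sum_congr rfl fun x _ => Finset.sum_congr rfl fun y _ => ?_
  simp only [j]
  rw [norm_algebraMap_add_mul h2, htr, hnorm]
  congr 1
  field_simp

end NormForm

/-! ### Canonical additive characters -/

section CanonicalCharacter

variable (p : ℕ) [Fact p.Prime] (F : Type*) [Field F] [Fintype F] [Algebra (ZMod p) F]

theorem canonicalAddChar_ne_one : canonicalAddChar p F ≠ 1 := by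
  intro h
  obtain ⟨x, hx⟩ := Algebra.trace_surjective (ZMod p) F 1
  have h1 : ZMod.stdAddChar (N := p) (Algebra.trace (ZMod p) F x) = 1 := DFunLike.congr_fun h x
  rw [hx, ← AddChar.map_zero_eq_one (ZMod.stdAddChar (N := p))] at h1
  exact one_ne_zero (ZMod.injective_stdAddChar h1)

theorem canonicalAddChar_isPrimitive : (canonicalAddChar p F).IsPrimitive :=
  AddChar.IsPrimitive.of_ne_one (canonicalAddChar_ne_one p F)

theorem canonicalAddChar_eq_comp_trace (K : Type*) [Field K] [Fintype K] [Algebra (ZMod p) K]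
    [Algebra F K] (z : K) :
    canonicalAddChar p K z = canonicalAddChar p F (Algebra.trace F K z) := by
  have : IsScalarTower (ZMod p) F K := IsScalarTower.of_algebraMap_eq' (Subsingleton.elim _ _)
  change ZMod.stdAddChar (N := p) _ = ZMod.stdAddChar (N := p) _
  exact congrArg (ZMod.stdAddChar (N := p)) (Algebra.trace_trace (R := ZMod p) (S := F) z).symm

end CanonicalCharacter

/-! ### Cyclotomic classes and the norm -/

section CyclotomicClasses

theorem mem_cyclotomicClass_iff {K : Type*} [Field K] {g : Kˣ} {e i : ℕ} {x : K} :
    x ∈ cyclotomicClass g e i ↔ ∃ k : ℤ, x = ((g ^ ((i : ℤ) + e * k) : Kˣ) : K) := by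
  constructor
  · rintro ⟨_, ⟨k, rfl⟩, rfl⟩
    exact ⟨k, by rw [zpow_add, zpow_mul, zpow_natCast, zpow_natCast]⟩
  · rintro ⟨k, rfl⟩
    exact ⟨(g ^ e) ^ k, ⟨k, rfl⟩, by rw [zpow_add, zpow_mul, zpow_natCast, zpow_natCast]⟩

theorem ne_zero_of_mem_cyclotomicClass {K : Type*} [Field K] {g : Kˣ} {e i : ℕ} {x : K}
    (hx : x ∈ cyclotomicClass g e i) : x ≠ 0 := by
  obtain ⟨k, rfl⟩ := mem_cyclotomicClass_iff.1 hx
  exact Units.ne_zero _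

theorem mul_mem_cyclotomicClass_iff {K : Type*} [Field K] {g : Kˣ} {e i s : ℕ} {y x : K}
    (hy : y ∈ cyclotomicClass g e s) :
    y * x ∈ cyclotomicClass g e (i + s) ↔ x ∈ cyclotomicClass g e i := by
  obtain ⟨k, rfl⟩ := mem_cyclotomicClass_iff.1 hy
  simp only [mem_cyclotomicClass_iff]
  constructor
  · rintro ⟨l, hl⟩
    refine ⟨l - k, ?_⟩
    refine mul_left_cancel₀ (Units.ne_zero (g ^ ((s : ℤ) + e * k))) (hl.trans ?_)
    rw [← Units.val_mul, ← zpow_add]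
    congr 2
    push_cast
    ring
  · rintro ⟨l, rfl⟩
    refine ⟨k + l, ?_⟩
    rw [← Units.val_mul, ← zpow_add]
    congr 2
    push_cast
    ring

theorem card_cyclotomicClass {F : Type*} [Field F] [Fintype F] {ω : Fˣ}
    (hω : ∀ x : Fˣ, x ∈ Subgroup.zpowers ω) {e : ℕ} (he : e ∣ Fintype.card F - 1) (i : ℕ)
    [DecidablePred (· ∈ cyclotomicClass ω e i)] :
    (Finset.univ.filter (· ∈ cyclotomicClass ω e i)).card = (Fintype.card F - 1) / e := by
  classical
  have h1 : cyclotomicClass ω e i =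
      Set.range fun h : Subgroup.zpowers (ω ^ e) => ((ω ^ i * h : Fˣ) : F) := by
    ext x
    simp only [cyclotomicClass, Set.mem_ofPred_eq, Set.mem_range, Subtype.exists, exists_prop]
    exact exists_congr fun h => and_congr_right fun _ => eq_comm
  have h2 : orderOf ω = Fintype.card F - 1 := by
    rw [orderOf_eq_card_of_forall_mem_zpowers hω, Nat.card_eq_fintype_card, Fintype.card_units]
  have h3 : (cyclotomicClass ω e i).ncard = (Fintype.card F - 1) / e := by
    rw [h1, ← Nat.card_coe_set_eq, Nat.card_range_of_injective, Nat.card_zpowers, orderOf_pow, h2,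
      Nat.gcd_eq_right he]
    intro h h' heq
    exact Subtype.ext (mul_left_cancel (Units.ext heq))
  rw [← h3, Set.ncard_eq_toFinset_card']
  congr 1
  ext
  simp

theorem forall_mem_zpowers_unitsMap_norm {F K : Type*} [Field F] [Field K] [Finite K]
    [Algebra F K] {γ : Kˣ} (hγ : ∀ x : Kˣ, x ∈ Subgroup.zpowers γ) (u : Fˣ) :
    u ∈ Subgroup.zpowers (Units.map (Algebra.norm F (S := K)) γ) := by
  obtain ⟨v, rfl⟩ := FiniteField.unitsMap_norm_surjective F K u
  obtain ⟨l, rfl⟩ := hγ v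
  exact ⟨l, (map_zpow _ γ l).symm⟩

theorem mem_smul_cyclotomicClass_iff {F K : Type*} [Field F] [Finite F] [Field K] [Finite K]
    [Algebra F K] {e : ℕ} (he : e ∣ Nat.card F - 1) {γ : Kˣ}
    (hγ : ∀ x : Kˣ, x ∈ Subgroup.zpowers γ) (n : ℕ) (z : K) :
    z ∈ ((γ ^ n : Kˣ) : K) • cyclotomicClass γ e 0 ↔
      Algebra.norm F z ∈ cyclotomicClass (Units.map (Algebra.norm F) γ) e n := by
  set φ : Kˣ →* Fˣ := Units.map (Algebra.norm F) with hφ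
  have hφv : ∀ u : Kˣ, Algebra.norm F (u : K) = (φ u : F) := fun u => rfl
  rw [Set.mem_smul_set, mem_cyclotomicClass_iff]
  constructor
  · rintro ⟨y, hy, rfl⟩
    obtain ⟨k, rfl⟩ := mem_cyclotomicClass_iff.1 hy
    refine ⟨k, ?_⟩
    rw [smul_eq_mul, ← Units.val_mul, hφv, ← zpow_natCast, ← zpow_add, map_zpow]
    simp
  · rintro ⟨k, hk⟩
    have hz : z ≠ 0 := by
      rintro rfl
      rw [Algebra.norm_zero] at hk
      exact Units.ne_zero _ hk.symm
    obtain ⟨j, hj⟩ := hγ (Units.mk0 z hz)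
    have hzj : z = ((γ ^ j : Kˣ) : K) := (congrArg Units.val hj).symm
    rw [hzj, hφv, map_zpow] at hk
    have hord : orderOf (φ γ) = Nat.card F - 1 := by
      rw [← Nat.card_units]
      exact orderOf_eq_card_of_forall_mem_zpowers (forall_mem_zpowers_unitsMap_norm hγ)
    -- Equality of norms fixes the exponent only modulo `q - 1`, which suffices since `e` divides `q
    -- - 1`.
    have hmod : (e : ℤ) ∣ j - (n + e * k) := by
      refine (Int.natCast_dvd_natCast.2 he).trans ?_
      rw [← hord, orderOf_dvd_iff_zpow_eq_one, zpow_sub, Units.ext hk, mul_inv_cancel]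
    obtain ⟨l, hl⟩ := hmod
    refine ⟨((γ ^ (e * (k + l)) : Kˣ) : K), mem_cyclotomicClass_iff.2 ⟨k + l, by simp⟩, ?_⟩
    rw [smul_eq_mul, ← Units.val_mul, ← zpow_natCast, ← zpow_add, hzj]
    congr 2
    linear_combination -hl

end CyclotomicClasses

/-! ### Kloosterman sums -/

section KloostermanSums

variable {F : Type*} [Field F] [Fintype F] [DecidableEq F]

/-- The Kloosterman sum `∑ t, ψ (-t⁻¹ a - t c)` over the nonzero elements of a finite field. -/
noncomputable def kloostermanSum (ψ : AddChar F ℂ) (a c : F) : ℂ :=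
  ∑ t : Fˣ, ψ (-((t : F)⁻¹ * a) - t * c)

theorem kloostermanSum_zero_zero (ψ : AddChar F ℂ) :
    kloostermanSum ψ 0 0 = (Fintype.card F : ℂ) - 1 := by
  simp [kloostermanSum, Fintype.card_units, Nat.cast_sub Fintype.card_pos]

theorem kloostermanSum_zero_left {ψ : AddChar F ℂ} (hψ : ψ.IsPrimitive) {c : F} (hc : c ≠ 0) :
    kloostermanSum ψ 0 c = -1 := by
  rw [← sum_units_char hψ (neg_ne_zero.2 hc)]
  exact Finset.sum_congr rfl fun t _ => by congr 1; ring

theorem kloostermanSum_zero_right {ψ : AddChar F ℂ} (hψ : ψ.IsPrimitive) {a : F} (ha : a ≠ 0) :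
    kloostermanSum ψ a 0 = -1 := by
  rw [← sum_units_char hψ (neg_ne_zero.2 ha), ← Equiv.sum_comp (Equiv.inv Fˣ)]
  refine Finset.sum_congr rfl fun t _ => ?_
  congr 1
  rw [Equiv.inv_apply, Units.val_inv_eq_inv_val]
  ring

theorem kloostermanSum_eq_one_mul (ψ : AddChar F ℂ) {a : F} (ha : a ≠ 0) (c : F) :
    kloostermanSum ψ a c = kloostermanSum ψ 1 (a * c) := by
  rw [kloostermanSum, ← Equiv.sum_comp (Equiv.mulRight (Units.mk0 a ha))]
  refine Finset.sum_congr rfl fun t _ => ?_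
  congr 1
  rw [Equiv.coe_mulRight, Units.val_mul, Units.val_mk0]
  field_simp

/-- The sum of the trace character over the elements of given norm in a quadratic extension. -/
theorem sum_trace_norm_eq {K : Type*} [Field K] [Fintype K] [Algebra F K]
    (h2 : Module.finrank F K = 2) {ψ : AddChar F ℂ} (hψ : ψ.IsPrimitive)
    (hL : ∑ z : K, ψ (Algebra.trace F K z) = 0) (u : F) :
    ∑ z : K with Algebra.norm F z = u, ψ (Algebra.trace F K z) = -kloostermanSum ψ 1 u := by
  classical
  have h := sum_level_set hψ (f := fun z : K => Algebra.norm F z)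
    (L := fun z => Algebra.trace F K z) (b := 1) (norm_add_smul_one h2) hL
    (fun t ht => sum_norm hψ h2 ht) u
  have hq : (Fintype.card F : ℂ) ≠ 0 := Nat.cast_ne_zero.2 Fintype.card_ne_zero
  refine mul_left_cancel₀ hq (h.trans ?_)
  rw [map_one, kloostermanSum]
  ring

end KloostermanSums

/-! ### Gauss sums of the two types -/

section QuadraticFormSums

theorem sum_filter_preimage {X F : Type*} [Fintype X] [Fintype F]
    [DecidableEq F] (f : X → F) (C : Set F) [DecidablePred (· ∈ C)] (g : X → ℂ) :
    ∑ x with f x ∈ C, g x = ∑ c with c ∈ C, ∑ x with f x = c, g x := by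
  simp only [Finset.sum_filter]
  have h : ∀ c, (if c ∈ C then ∑ x, (if f x = c then g x else 0) else 0) =
      ∑ x, if f x = c then (if c ∈ C then g x else 0) else 0 := by
    intro c
    split_ifs <;> simp
  simp only [h]
  rw [Finset.sum_comm]
  exact Finset.sum_congr rfl fun x _ => by simp

theorem sum_mul_eq_of_isHyperbolic {F V : Type*} [Field F] [Fintype F] [AddCommGroup V]
    [Module F V] [Fintype V] {m : ℕ} (hV : Module.finrank F V = 2 * m) {Q : QuadraticForm F V}
    (hQ : IsHyperbolic Q) {ψ : AddChar F ℂ} (hψ : ψ.IsPrimitive) {t : F} (ht : t ≠ 0) :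
    ∑ x, ψ (t * Q x) = (Fintype.card F : ℂ) ^ m := by
  obtain ⟨n, h⟩ := hQ
  have hn : n = m := by
    obtain ⟨f⟩ := h
    have := f.toLinearEquiv.finrank_eq
    rw [Module.finrank_fin_fun] at this
    omega
  rw [sum_comp_of_equivalent h fun y => ψ (t * y), sum_hyperbolicForm hψ ht, hn]

theorem sum_mul_eq_of_isElliptic {F K V : Type*} [Field F] [Fintype F] [Field K] [Fintype K]
    [Algebra F K] (h2 : Module.finrank F K = 2) [AddCommGroup V]
    [Module F V] [Fintype V] {m : ℕ} (hV : Module.finrank F V = 2 * m) {Q : QuadraticForm F V}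
    (hQ : IsElliptic Q) {ψ : AddChar F ℂ} (hψ : ψ.IsPrimitive) {t : F} (ht : t ≠ 0) :
    ∑ x, ψ (t * Q x) = -(Fintype.card F : ℂ) ^ m := by
  classical
  obtain ⟨k, a, b, c, hirr, h⟩ := hQ
  have hk : m = k + 1 := by
    obtain ⟨f⟩ := h
    have := f.toLinearEquiv.finrank_eq
    rw [Module.finrank_fin_fun] at this
    omega
  rw [sum_comp_of_equivalent h fun y => ψ (t * y), sum_ellipticForm hψ ht
    (sum_anisotropic_binary (K := K) hψ h2
      (anisotropic_of_irreducible_binaryPolynomial a b c hirr) ht), hk, pow_succ]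
  ring

end QuadraticFormSums

/-! ### The character values -/

theorem lemma4p2 (p : ℕ) [Fact p.Prime]
    -- the fields `F = F_q` and `K = F_{q²}`, both of characteristic `p`
    (F : Type*) [Field F] [Fintype F] [Algebra (ZMod p) F]
    (K : Type*) [Field K] [Fintype K] [Algebra (ZMod p) K] [Algebra F K]
    (q : ℕ) (hF : Fintype.card F = q) (hK : Fintype.card K = q ^ 2)
    -- a nonsingular quadratic form on a space of even dimension `2 m > 0`: no nonzero `w` has
    -- both `Q w = 0` and `B(v, w) = 0` for all `v`
    (V : Type*) [AddCommGroup V] [Module F V] [Fintype V]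
    (m : ℕ) (hm : 0 < m) (hV : Module.finrank F V = 2 * m)
    (Q : QuadraticForm F V) (hQ : Q.radical = ⊥)
    (e : ℕ) (he : e ∣ q - 1)
    -- a primitive element `γ` of `K` and its norm `ω`
    (γ : Kˣ) (hγ : ∀ x : Kˣ, x ∈ Subgroup.zpowers γ)
    (ω : Fˣ) (hω : (ω : F) = Algebra.norm F (γ : K)) :
    (IsHyperbolic Q ∨ IsElliptic Q) ∧
    ∀ ε : ℤ, (IsHyperbolic Q ∧ ε = 1 ∨ IsElliptic Q ∧ ε = -1) →
    ∀ b : V, b ≠ 0 →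
      (∀ i < e,
        (Q b = 0 →
          charSum (polarChar p Q b) {x | Q x ∈ cyclotomicClass ω e i} =
            -(ε : ℂ) * (q : ℂ) ^ (m - 1) * (((q : ℂ) - 1) / (e : ℂ))) ∧
        (∀ s < e, Q b ∈ cyclotomicClass ω e s →
          charSum (polarChar p Q b) {x | Q x ∈ cyclotomicClass ω e i} =
            -(ε : ℂ) * (q : ℂ) ^ (m - 1) *
              charSum (canonicalAddChar p K)
                (((γ ^ (i + s) : Kˣ) : K) • cyclotomicClass γ e 0))) ∧
      (Q b = 0 →
        charSum (polarChar p Q b) {x | Q x = 0} =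
          (ε : ℂ) * (q : ℂ) ^ (m - 1) * ((q : ℂ) - 1)) ∧
      (Q b ≠ 0 →
        charSum (polarChar p Q b) {x | Q x = 0} = -(ε : ℂ) * (q : ℂ) ^ (m - 1)) := by
  classical
  subst hF
  have hF1 : 1 < Fintype.card F := Fintype.one_lt_card
  have hq : (Fintype.card F : ℂ) ≠ 0 := Nat.cast_ne_zero.2 Fintype.card_ne_zero
  have h2 : Module.finrank F K = 2 := by
    rw [Module.card_eq_pow_finrank (K := F) (V := K)] at hK
    exact Nat.pow_right_injective hF1 hK
  have hωγ : ω = Units.map (Algebra.norm F (S := K)) γ := Units.ext hω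
  have hψ := canonicalAddChar_isPrimitive p F
  set ψ := canonicalAddChar p F with hψdef
  refine ⟨equivalent_hyperbolicForm_or_ellipticForm m Q inferInstance hV hQ |>.imp
    (fun h => ⟨m, h⟩) id, fun ε hε b hb => ?_⟩
  -- Apart from `ε ≠ 0`, the type of `Q` enters the character values only here.
  have hG : ∀ t : F, t ≠ 0 → ∑ x, ψ (t * Q x) = ε * (Fintype.card F : ℂ) ^ m := by
    intro t ht
    rcases hε with ⟨h, rfl⟩ | ⟨h, rfl⟩
    · simp [sum_mul_eq_of_isHyperbolic hV h hψ ht]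
    · simp [sum_mul_eq_of_isElliptic (K := K) h2 hV h hψ ht]
  have hε0 : (ε : ℂ) ≠ 0 := by rcases hε with ⟨h, rfl⟩ | ⟨h, rfl⟩ <;> simp
  obtain ⟨x₀, hx₀⟩ := exists_polarBilin_ne_zero hψ Q hQ (mul_ne_zero hε0 (pow_ne_zero m hq)) hG hb
  have hchar : ∀ x, polarChar p Q b x = ψ (Q.polarBilin b x) := fun x => rfl
  have hL : ∑ x, ψ (Q.polarBilin b x) = 0 := by
    refine (Finset.sum_congr rfl fun x _ => (hchar x).symm).trans
      (AddChar.sum_eq_zero_of_ne_one fun h1 => hψ hx₀ (DFunLike.ext _ _ fun t => ?_))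
    have h3 := DFunLike.congr_fun h1 (t • x₀)
    rw [hchar, map_smul, smul_eq_mul, mul_comm] at h3
    exact h3
  have hlevel : ∀ c, ∑ x with Q x = c, ψ (Q.polarBilin b x) =
      ε * (Fintype.card F : ℂ) ^ (m - 1) * kloostermanSum ψ (Q b) c := by
    intro c
    have h := sum_level_set hψ (f := Q) (L := fun x => Q.polarBilin b x) (b := b)
      (fun x s => QuadraticMap.map_add_smul_eq Q x b s) hL hG c
    refine mul_left_cancel₀ hq (h.trans ?_)
    obtain ⟨n, rfl⟩ : ∃ n, m = n + 1 := ⟨m - 1, by omega⟩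
    rw [kloostermanSum, Nat.add_sub_cancel, pow_succ]
    ring
  have hclass : ∀ i, charSum (polarChar p Q b) {x | Q x ∈ cyclotomicClass ω e i} =
      ε * (Fintype.card F : ℂ) ^ (m - 1) *
        ∑ c with c ∈ cyclotomicClass ω e i, kloostermanSum ψ (Q b) c := by
    intro i
    rw [Finset.mul_sum, ← Finset.sum_congr rfl fun c _ => hlevel c, ← sum_filter_preimage Q]
    rfl
  have hzero : charSum (polarChar p Q b) {x | Q x = 0} =
      ε * (Fintype.card F : ℂ) ^ (m - 1) * kloostermanSum ψ (Q b) 0 := by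
    rw [← hlevel]
    rfl
  refine ⟨fun i hi => ⟨fun hQb => ?_, fun s hs hQb => ?_⟩, fun hQb => ?_, fun hQb => ?_⟩
  · have he0 : (e : ℂ) ≠ 0 := Nat.cast_ne_zero.2 (by omega)
    rw [hclass, hQb, Finset.sum_congr rfl fun c hc => kloostermanSum_zero_left hψ
      (ne_zero_of_mem_cyclotomicClass (Finset.mem_filter.1 hc).2), Finset.sum_const,
      card_cyclotomicClass (hωγ ▸ forall_mem_zpowers_unitsMap_norm hγ) he, nsmul_eq_mul,
      Nat.cast_div he he0, Nat.cast_sub hF1.le]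
    push_cast
    ring
  · have hQb0 := ne_zero_of_mem_cyclotomicClass hQb
    have hLK : ∑ z : K, ψ (Algebra.trace F K z) = 0 := by
      simp only [hψdef, ← canonicalAddChar_eq_comp_trace]
      exact AddChar.sum_eq_zero_of_ne_one (canonicalAddChar_ne_one p K)
    -- The class in `K` is a union of norm fibres; the minus sign comes from the Gauss sum `-q` of
    -- the norm form.
    have hKsum : charSum (canonicalAddChar p K)
        (((γ ^ (i + s) : Kˣ) : K) • cyclotomicClass γ e 0) =
        -∑ u with u ∈ cyclotomicClass ω e (i + s), kloostermanSum ψ 1 u := by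
      rw [← Finset.sum_neg_distrib, ← Finset.sum_congr rfl fun u _ =>
        sum_trace_norm_eq (K := K) h2 hψ hLK u,
        ← sum_filter_preimage (fun z : K => Algebra.norm F z)]
      rw [charSum]
      refine Finset.sum_congr ?_ fun z _ => canonicalAddChar_eq_comp_trace p F K z
      ext z
      simp only [Finset.mem_filter, Finset.mem_univ, true_and, hωγ]
      exact mem_smul_cyclotomicClass_iff (by rwa [← Fintype.card_eq_nat_card]) hγ _ _
    -- The Kloosterman sum depends only on the product of its arguments when `Q b ≠ 0`, and
    -- multiplication by `Q b` carries class `i` onto class `i + s`.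
    have hre : ∑ c with c ∈ cyclotomicClass ω e i, kloostermanSum ψ (Q b) c =
        ∑ u with u ∈ cyclotomicClass ω e (i + s), kloostermanSum ψ 1 u := by
      rw [Finset.sum_filter, Finset.sum_filter, ← Equiv.sum_comp (Equiv.mulLeft₀ (Q b) hQb0)
        (fun u => if u ∈ cyclotomicClass ω e (i + s) then kloostermanSum ψ 1 u else 0)]
      refine Finset.sum_congr rfl fun c _ => ?_
      change _ = if Q b * c ∈ cyclotomicClass ω e (i + s) then kloostermanSum ψ 1 (Q b * c) else 0
      simp only [mul_mem_cyclotomicClass_iff hQb,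
        kloostermanSum_eq_one_mul ψ hQb0 c]
    rw [hclass, hKsum, hre]
    ring
  · rw [hzero, hQb, kloostermanSum_zero_zero]
  · rw [hzero, kloostermanSum_zero_right hψ hQb]
    ring
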